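/- Let $X$ be a compact complex manifold, and for a Hermitian metric $h$ on (the holomorphic tangent bundle of) $X$ let $R^h$ be the Chern curvature tensor of $(T_X,h)$, in local holomorphic coordinates $$R_{i\bar j k\bar l}=-\frac{\partial^2 h_{k\bar l}}{\partial z^i\partial\bar z^j}+h^{p\bar q}\frac{\partial h_{k\bar q}}{\partial z^i}\frac{\partial h_{p\bar l}}{\partial\bar z^j}.$$ The metric $h$ has positive holomorphic sectional curvature if $R^h(v,\bar v,v,\bar v)/|v|_h^4>0$ for all nonzero $v\in T_X$, and it is conformally Kähler if $e^{-2f}h$ is a Kähler metric for some $f\in C^\infty(X,\mathbb R)$. For an integer $p\ge 1$, $(T_X,h)$ is BC-$p$ positive if for every $x\in X$ and every $p$-dimensional complex subspace $\Sigma\subset T_{X,x}$ there is $v\in T_{X,x}$ such that $\sum_{i=1}^p R^h(v,\bar v,e_i,\bar e_i)>0$, where $(e_i)$ is a unitary basis of $\Sigma$ (the sum does not depend on the choice of this basis); $T_X$ is BC-$p$ positive if $(T_X,h')$ is BC-$p$ positive for some Hermitian metric $h'$ on $X$. **Proposition.** Let $h$ be a conformally Kähler metric with positive holomorphic sectional curvature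 on a compact complex manifold $X$. Then $T_X$ is BC-$p$ positive for every $p\ge 1$. More precisely, whenever $f\in C^\infty(X,\mathbb R)$ is such that $g=e^{-2f}h$ is Kähler, $(T_X,e^{\frac{p+1}{p}f}g)$ is BC-$p$ positive for every $p\ge1$. -/

import Mathlib

open scoped Manifold ContDiff ComplexConjugate

noncomputable section

/-- The model space `ℂⁿ`. -/
abbrev CModel (n : ℕ) : Type := EuclideanSpace ℂ (Fin n)

/-- The `k`-th coordinate vector of `ℂⁿ`. -/
def coordVec {n : ℕ} (k : Fin n) : CModel n := EuclideanSpace.single k 1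

/-! ### Wirtinger derivatives on `ℂⁿ` -/

/-- `∂F/∂zⁱ = (∂F/∂xⁱ - √-1 ∂F/∂yⁱ) / 2` for a (real differentiable) function `F` on `ℂⁿ`. -/
def wirtingerD {n : ℕ} (i : Fin n) (F : CModel n → ℂ) (z : CModel n) : ℂ :=
  (fderiv ℝ F z (coordVec i) - Complex.I * fderiv ℝ F z (Complex.I • coordVec i)) / 2

/-- `∂F/∂z̄ʲ = (∂F/∂xʲ + √-1 ∂F/∂yʲ) / 2` for a (real differentiable) function `F` on `ℂⁿ`. -/
def wirtingerDbar {n : ℕ} (j : Fin n) (F : CModel n → ℂ) (z : CModel n) : ℂ :=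
  (fderiv ℝ F z (coordVec j) + Complex.I * fderiv ℝ F z (Complex.I • coordVec j)) / 2

/-! ### Hermitian metrics on a complex manifold -/

section Manifold

variable {n : ℕ} {X : Type*} [TopologicalSpace X] [ChartedSpace (CModel n) X]

/-- For a chart `e` of `X` and a point `z` of its target, `coordField e z u` is the tangent vector
at `e.symm z` with constant components `u` in the coordinates of `e`, that is `∑ uᵏ ∂/∂zᵏ`. -/
def coordField (e : OpenPartialHomeomorph X (CModel n)) (z : CModel n) :
    CModel n →L[ℂ] TangentSpace 𝓘(ℂ, CModel n) (e.symm z) :=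
  mfderiv 𝓘(ℂ, CModel n) 𝓘(ℂ, CModel n) e.symm z

/-- The components in the chart `e` of a tangent vector at `x`. -/
def tangentCoord (e : OpenPartialHomeomorph X (CModel n)) (x : X) :
    TangentSpace 𝓘(ℂ, CModel n) x →L[ℂ] CModel n :=
  mfderiv 𝓘(ℂ, CModel n) 𝓘(ℂ, CModel n) e x

variable (n X)

/-- A (smooth) Hermitian metric on the holomorphic tangent bundle of a complex manifold `X` of
dimension `n`. Each `form x` is complex linear in the first and conjugate linear in the second
variable. Holomorphic tangent vectors are modelled by the tangent space of `X` as a manifold over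
`ℂ`. Smoothness is real `C^∞`-smoothness of the metric coefficients in holomorphic charts. -/
structure HermitianMetric where
  form : ∀ x : X, TangentSpace 𝓘(ℂ, CModel n) x →ₗ[ℂ] TangentSpace 𝓘(ℂ, CModel n) x →ₗ⋆[ℂ] ℂ
  conj_symm : ∀ (x : X) (u v : TangentSpace 𝓘(ℂ, CModel n) x), conj (form x v u) = form x u v
  pos : ∀ (x : X) (u : TangentSpace 𝓘(ℂ, CModel n) x), u ≠ 0 → 0 < (form x u u).re
  smooth : ∀ e ∈ atlas (CModel n) X, ∀ u v : CModel n,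
    ContDiffOn ℝ ∞ (fun z => form (e.symm z) (coordField e z u) (coordField e z v)) e.target

/-- A complex manifold is a real `C^∞` manifold with the same charts. -/
theorem isManifold_real [IsManifold 𝓘(ℂ, CModel n) ω X] : IsManifold 𝓘(ℝ, CModel n) ∞ X := by
  refine isManifold_of_contDiffOn _ _ _ fun e e' he he' => ?_
  have h1 := (contDiffGroupoid ω 𝓘(ℂ, CModel n)).compatible he he'
  rw [contDiffGroupoid, mem_groupoid_of_pregroupoid] at h1
  have h2 : ContDiffOn ℂ ω _ _ := h1.1
  exact (h2.restrict_scalars ℝ).of_le le_top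

variable {n X}

/-- The Hermitian metric `e^φ h`, for a real-valued smooth function `φ` on `X`. -/
def HermitianMetric.expMul [IsManifold 𝓘(ℂ, CModel n) ω X] (h : HermitianMetric n X)
    (φ : C^∞⟮𝓘(ℝ, CModel n), X; ℝ⟯) : HermitianMetric n X where
  form x := (Real.exp (φ x) : ℂ) • h.form x
  conj_symm x u v := by
    simp only [LinearMap.smul_apply, smul_eq_mul, map_mul, Complex.conj_ofReal, h.conj_symm]
  pos x u hu := by
    simp only [LinearMap.smul_apply, smul_eq_mul, Complex.re_ofReal_mul]
    exact mul_pos (Real.exp_pos _) (h.pos x u hu)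
  smooth e he u v := by
    have : IsManifold 𝓘(ℝ, CModel n) ∞ X := isManifold_real n X
    have h1 : ContMDiffOn 𝓘(ℝ, CModel n) 𝓘(ℝ, CModel n) ∞ e.symm e.target :=
      contMDiffOn_symm_of_mem_maximalAtlas (IsManifold.subset_maximalAtlas he)
    have h2 : ContDiffOn ℝ ∞ (fun z => φ (e.symm z)) e.target :=
      (φ.contMDiff.comp_contMDiffOn h1).contDiffOn
    exact (Complex.ofRealCLM.contDiff.comp_contDiffOn h2.exp).mul (h.smooth e he u v)

/-- The metric `h` in the chart `e`: the Hermitian form on `ℂⁿ` at the point `z` whose value at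
coordinate vectors is `h_{k l̄}(z)`. -/
def HermitianMetric.inChart (h : HermitianMetric n X) (e : OpenPartialHomeomorph X (CModel n))
    (z : CModel n) : CModel n →ₗ[ℂ] CModel n →ₗ⋆[ℂ] ℂ :=
  LinearMap.mk₂'ₛₗ (RingHom.id ℂ) (starRingEnd ℂ)
    (fun u v => h.form (e.symm z) (coordField e z u) (coordField e z v))
    (fun u u' v => by rw [map_add, map_add, LinearMap.add_apply])
    (fun c u v => by rw [map_smul, map_smul, LinearMap.smul_apply]; rfl)
    (fun u v v' => by rw [map_add, map_add])
    (fun c u v => by rw [map_smul, map_smulₛₗ])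

theorem HermitianMetric.inChart_real_smul (h : HermitianMetric n X)
    (e : OpenPartialHomeomorph X (CModel n)) (z u v : CModel n) (c : ℝ) :
    h.inChart e z u (c • v) = c * h.inChart e z u v := by
  rw [← Complex.coe_smul, map_smulₛₗ, Complex.conj_ofReal, smul_eq_mul]

theorem HermitianMetric.inChart_conj_symm (h : HermitianMetric n X)
    (e : OpenPartialHomeomorph X (CModel n)) (z u v : CModel n) :
    conj (h.inChart e z v u) = h.inChart e z u v :=
  h.conj_symm _ _ _

/-! ### The Kähler form and the Kähler condition -/

/-- The real two-form `(u, v) ↦ -Im h(u, v)` (which is `Re h(√-1 u, v)`) of the metric `h`, as a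
differential form on `ℂⁿ` in the chart `e`. It is the real form associated with
`√-1 ∑ h_{k l̄} dzᵏ ∧ dz̄ˡ`, up to a positive constant factor. -/
def HermitianMetric.kahlerForm (h : HermitianMetric n X)
    (e : OpenPartialHomeomorph X (CModel n)) (z : CModel n) : CModel n [⋀^Fin 2]→L[ℝ] ℝ where
  toFun m := -(h.inChart e z (m 0) (m 1)).im
  map_update_add' m i x y := by
    fin_cases i <;> simp <;> ring
  map_update_smul' m i c x := by
    fin_cases i <;> simp [h.inChart_real_smul]
  map_eq_zero_of_eq' m i j hm hij := by
    have h01 : m 0 = m 1 := by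
      fin_cases i <;> fin_cases j <;> simp_all
    have := congrArg Complex.im (h.inChart_conj_symm e z (m 0) (m 0))
    rw [Complex.conj_im] at this
    rw [← h01]
    linarith
  cont := by
    let L : CModel n →ₗ[ℝ] CModel n →ₗ[ℝ] ℝ :=
      LinearMap.mk₂ ℝ (fun u v => -(h.inChart e z u v).im)
        (fun u u' v => by simp; ring) (fun c u v => by simp)
        (fun u v v' => by simp; ring) (fun c u v => by simp [h.inChart_real_smul])
    let L' : CModel n →ₗ[ℝ] CModel n →L[ℝ] ℝ := LinearMap.toContinuousLinearMap.toLinearMap ∘ₗ L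
    have hL : Continuous L' := L'.continuous_of_finiteDimensional
    change Continuous fun m : Fin 2 → CModel n => L' (m 0) (m 1)
    exact (hL.comp (continuous_apply 0)).clm_apply (continuous_apply 1)

/-- A Hermitian metric is Kähler if its Kähler form is closed. -/
def HermitianMetric.IsKahler (h : HermitianMetric n X) : Prop :=
  ∀ e ∈ atlas (CModel n) X, ∀ z ∈ e.target, extDeriv (h.kahlerForm e) z = 0

/-- A Hermitian metric `h` is conformally Kähler if `e^{-2f} h` is Kähler for some real-valued
smooth function `f` on the whole manifold. -/
def HermitianMetric.IsConformallyKahler [IsManifold 𝓘(ℂ, CModel n) ω X]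
    (h : HermitianMetric n X) : Prop :=
  ∃ f : C^∞⟮𝓘(ℝ, CModel n), X; ℝ⟯, (h.expMul ((-2 : ℝ) • f)).IsKahler

/-! ### Chern curvature -/

/-- The coefficient `h_{k l̄} = h(∂/∂zᵏ, ∂/∂zˡ)` in the chart `e`. -/
def HermitianMetric.coeff (h : HermitianMetric n X) (e : OpenPartialHomeomorph X (CModel n))
    (k l : Fin n) (z : CModel n) : ℂ :=
  h.inChart e z (coordVec k) (coordVec l)

/-- The inverse coefficients `h^{p q̄}`, normalised by `∑_q h^{p q̄} h_{r q̄} = δ_{pr}`. -/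
def HermitianMetric.invCoeff (h : HermitianMetric n X) (e : OpenPartialHomeomorph X (CModel n))
    (p q : Fin n) (z : CModel n) : ℂ :=
  (Matrix.of fun k l => h.coeff e k l z)⁻¹ q p

/-- The components of the Chern curvature tensor in the chart `e`,
`R_{i j̄ k l̄} = -∂²h_{k l̄}/∂zⁱ∂z̄ʲ + h^{p q̄} (∂h_{k q̄}/∂zⁱ) (∂h_{p l̄}/∂z̄ʲ)`. -/
def HermitianMetric.curvCoeff (h : HermitianMetric n X) (e : OpenPartialHomeomorph X (CModel n))
    (i j k l : Fin n) (z : CModel n) : ℂ :=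
  -wirtingerD i (wirtingerDbar j (h.coeff e k l)) z
    + ∑ p, ∑ q, h.invCoeff e p q z * wirtingerD i (h.coeff e k q) z
        * wirtingerDbar j (h.coeff e p l) z

/-- The Chern curvature `R(v, v̄, u, ū)` of `(T_X, h)` at `x`, where `v` is the direction and `u`
the vector in the bundle, computed in the preferred holomorphic chart at `x`. (The Chern curvature
is a tensor, so that every other holomorphic chart gives the same number; this number is real,
and we take its real part to have it in `ℝ`.) -/
def HermitianMetric.chernCurv (h : HermitianMetric n X) (x : X)
    (v u : TangentSpace 𝓘(ℂ, CModel n) x) : ℝ :=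
  (∑ i, ∑ j, ∑ k, ∑ l, h.curvCoeff (chartAt (CModel n) x) i j k l (chartAt (CModel n) x x)
    * tangentCoord (chartAt (CModel n) x) x v i * conj (tangentCoord (chartAt (CModel n) x) x v j)
    * tangentCoord (chartAt (CModel n) x) x u k
    * conj (tangentCoord (chartAt (CModel n) x) x u l)).re

/-- The holomorphic sectional curvature `R(v, v̄, v, v̄) / |v|⁴` of `h`. -/
def HermitianMetric.holSecCurv (h : HermitianMetric n X) (x : X)
    (v : TangentSpace 𝓘(ℂ, CModel n) x) : ℝ :=
  h.chernCurv x v v / (h.form x v v).re ^ 2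

/-- Positive holomorphic sectional curvature. -/
def HermitianMetric.HasPositiveHSC (h : HermitianMetric n X) : Prop :=
  ∀ (x : X) (v : TangentSpace 𝓘(ℂ, CModel n) x), v ≠ 0 → 0 < h.holSecCurv x v

/-! ### BC-`p` positivity of the tangent bundle -/

/-- `(T_X, h)` is BC-`p` positive: for every `x` and every `p`-dimensional complex subspace `S` of
`T_{X,x}` there is a `v ∈ T_{X,x}` with `∑ᵢ R(v, v̄, eᵢ, ēᵢ) > 0` for unitary bases `(eᵢ)` of `S`
(the sum does not depend on the unitary basis). -/
def HermitianMetric.IsBCPositive (h : HermitianMetric n X) (p : ℕ) : Prop :=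
  ∀ (x : X) (S : Submodule ℂ (TangentSpace 𝓘(ℂ, CModel n) x)), Module.finrank ℂ S = p →
    ∃ v : TangentSpace 𝓘(ℂ, CModel n) x,
      ∀ b : Module.Basis (Fin p) ℂ S,
        (∀ i j, h.form x (b i : TangentSpace 𝓘(ℂ, CModel n) x) (b j) = if i = j then 1 else 0) →
        0 < ∑ i, h.chernCurv x v (b i)

variable (n X) in
/-- The tangent bundle `T_X` is BC-`p` positive: it admits a Hermitian metric `h` such that
`(T_X, h)` is BC-`p` positive. -/
def TangentBundleBCPositive (p : ℕ) : Prop :=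
  ∃ h : HermitianMetric n X, h.IsBCPositive p

end Manifold

end

/-! ### Wirtinger calculus on `ℂⁿ`. -/

section Wirtinger

variable {n : ℕ} {F G : CModel n → ℂ} {z : CModel n}

/-! Write `g = e^{-2f} h`. A conformal change only subtracts a Hessian: `R(e^φ g) = e^φ (R(g) - ∂∂̄φ
⊗ g)` (`curvCoeff_expMul`). Hence positive holomorphic sectional curvature of `h` says that
`R^g(v,v̄,v,v̄) - 2 ∂∂̄f(v,v̄) g(v,v̄) > 0` for all `v ≠ 0`.

Since `g` is Kähler, `R^g` is symmetric in its two holomorphic and in its two antiholomorphic slots.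
Symmetrizing the product `2 ∂∂̄f ⊗ g` in the same way gives a tensor `a` with these symmetries and
`a(v,v̄,v,v̄) > 0`. For linearly independent `e_1, …, e_p`, averaging `a` on the diagonal over the
vectors `∑ εᵢ eᵢ` with unimodular `εᵢ` leaves `2 ∑_{i,k} a(eᵢ,ēᵢ,e_k,ē_k) - ∑ᵢ a(eᵢ,ēᵢ,eᵢ,ēᵢ) > 0`,
so the double sum is positive (`sum_quarticForm_pos`). This is the discrete form of Berger's
averaging over the unit sphere of `Σ`.

If moreover `g(eᵢ,e_j) = c δᵢⱼ`, the double sum equals `∑ᵢ (∑_k R^g(eᵢ,ēᵢ,e_k,ē_k) - (p+1) c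
∂∂̄f(eᵢ,ēᵢ))` (`HermitianMetric.IsKahler.sum_chernCurv_sub_pos`). Some summand is positive, and `v =
eᵢ` works: for the weight `(p+1)/p · f`, the trace over `Σ` of the Hessian correction is exactly
`(p+1) c ∂∂̄f(v,v̄)`. -/

theorem wirtingerD_congr (i : Fin n) (h : F =ᶠ[nhds z] G) : wirtingerD i F z = wirtingerD i G z := by
  simp only [wirtingerD, h.fderiv_eq]

theorem wirtingerDbar_congr (i : Fin n) (h : F =ᶠ[nhds z] G) :
    wirtingerDbar i F z = wirtingerDbar i G z := by
  simp only [wirtingerDbar, h.fderiv_eq]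

theorem wirtingerD_add (i : Fin n) (hF : DifferentiableAt ℝ F z) (hG : DifferentiableAt ℝ G z) :
    wirtingerD i (fun w => F w + G w) z = wirtingerD i F z + wirtingerD i G z := by
  simp only [wirtingerD, fderiv_fun_add hF hG, add_apply]
  ring

theorem wirtingerD_mul (i : Fin n) (hF : DifferentiableAt ℝ F z) (hG : DifferentiableAt ℝ G z) :
    wirtingerD i (fun w => F w * G w) z = wirtingerD i F z * G z + F z * wirtingerD i G z := by
  simp only [wirtingerD, fderiv_fun_mul hF hG, add_apply,
    smul_apply, smul_eq_mul]
  ring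

theorem wirtingerDbar_mul (i : Fin n) (hF : DifferentiableAt ℝ F z) (hG : DifferentiableAt ℝ G z) :
    wirtingerDbar i (fun w => F w * G w) z
      = wirtingerDbar i F z * G z + F z * wirtingerDbar i G z := by
  simp only [wirtingerDbar, fderiv_fun_mul hF hG, add_apply,
    smul_apply, smul_eq_mul]
  ring

theorem wirtingerD_const_mul (i : Fin n) (c : ℂ) (hF : DifferentiableAt ℝ F z) :
    wirtingerD i (fun w => c * F w) z = c * wirtingerD i F z := by
  rw [wirtingerD_mul i (differentiableAt_const c) hF]
  simp [wirtingerD]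

theorem wirtingerDbar_const_mul (i : Fin n) (c : ℂ) (hF : DifferentiableAt ℝ F z) :
    wirtingerDbar i (fun w => c * F w) z = c * wirtingerDbar i F z := by
  rw [wirtingerDbar_mul i (differentiableAt_const c) hF]
  simp [wirtingerDbar]

theorem wirtingerD_exp (i : Fin n) (hF : DifferentiableAt ℝ F z) :
    wirtingerD i (fun w => Complex.exp (F w)) z = Complex.exp (F z) * wirtingerD i F z := by
  simp only [wirtingerD, hF.hasFDerivAt.cexp.fderiv, smul_apply, smul_eq_mul]
  ring

theorem wirtingerDbar_exp (i : Fin n) (hF : DifferentiableAt ℝ F z) :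
    wirtingerDbar i (fun w => Complex.exp (F w)) z = Complex.exp (F z) * wirtingerDbar i F z := by
  simp only [wirtingerDbar, hF.hasFDerivAt.cexp.fderiv, smul_apply,
    smul_eq_mul]
  ring

theorem fderiv_conj_apply (v : CModel n) (hF : DifferentiableAt ℝ F z) :
    fderiv ℝ (fun w => conj (F w)) z v = conj (fderiv ℝ F z v) := by
  have := (Complex.conjCLE.toContinuousLinearMap.hasFDerivAt.comp z hF.hasFDerivAt).fderiv
  exact DFunLike.congr_fun this v

theorem conj_wirtingerD (i : Fin n) (hF : DifferentiableAt ℝ F z) :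
    conj (wirtingerD i F z) = wirtingerDbar i (fun w => conj (F w)) z := by
  simp only [wirtingerD, wirtingerDbar, fderiv_conj_apply _ hF, map_div₀, map_sub, map_mul,
    Complex.conj_I, map_ofNat]
  ring

theorem conj_wirtingerDbar (i : Fin n) (hF : DifferentiableAt ℝ F z) :
    conj (wirtingerDbar i F z) = wirtingerD i (fun w => conj (F w)) z := by
  simp only [wirtingerD, wirtingerDbar, fderiv_conj_apply _ hF, map_div₀, map_add, map_mul,
    Complex.conj_I, map_ofNat]
  ring

theorem contDiffAt_fderiv_apply (hF : ContDiffAt ℝ ∞ F z) (v : CModel n) :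
    ContDiffAt ℝ ∞ (fun w => fderiv ℝ F w v) z :=
  (hF.fderiv_right (m := ∞) (by simp)).clm_apply contDiffAt_const

theorem ContDiffAt.wirtingerD (hF : ContDiffAt ℝ ∞ F z) (i : Fin n) :
    ContDiffAt ℝ ∞ (wirtingerD i F) z :=
  ((contDiffAt_fderiv_apply hF _).sub
    (contDiffAt_const.mul (contDiffAt_fderiv_apply hF _))).div_const _

theorem ContDiffAt.wirtingerDbar (hF : ContDiffAt ℝ ∞ F z) (i : Fin n) :
    ContDiffAt ℝ ∞ (wirtingerDbar i F) z :=
  ((contDiffAt_fderiv_apply hF _).add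
    (contDiffAt_const.mul (contDiffAt_fderiv_apply hF _))).div_const _

theorem ContDiffAt.real_differentiableAt (hF : ContDiffAt ℝ ∞ F z) : DifferentiableAt ℝ F z :=
  hF.differentiableAt (by simp)

theorem fderiv_wirtingerD (hF : ContDiffAt ℝ ∞ F z) (i : Fin n) (v : CModel n) :
    fderiv ℝ (_root_.wirtingerD i F) z v = (fderiv ℝ (fderiv ℝ F) z v (coordVec i)
      - Complex.I * fderiv ℝ (fderiv ℝ F) z v (Complex.I • coordVec i)) / 2 := by
  have hd : DifferentiableAt ℝ (fderiv ℝ F) z :=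
    (hF.fderiv_right (m := ∞) (by simp)).differentiableAt (by simp)
  have h1 (u : CModel n) :
      HasFDerivAt (fun w => fderiv ℝ F w u) ((fderiv ℝ (fderiv ℝ F) z).flip u) z := by
    simpa using! hd.hasFDerivAt.clm_apply (hasFDerivAt_const u z)
  have h2 := (((h1 (coordVec i)).sub ((h1 (Complex.I • coordVec i)).const_mul Complex.I)).mul_const
    (2⁻¹ : ℂ)).fderiv
  have h3 := DFunLike.congr_fun h2 v
  have h4 : _root_.wirtingerD i F = fun w => (fderiv ℝ F w (coordVec i)
      - Complex.I * fderiv ℝ F w (Complex.I • coordVec i)) * (2⁻¹ : ℂ) := by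
    funext w
    simp only [_root_.wirtingerD, div_eq_mul_inv]
  rw [h4]
  refine h3.trans ?_
  simp
  ring

theorem fderiv_wirtingerDbar (hF : ContDiffAt ℝ ∞ F z) (i : Fin n) (v : CModel n) :
    fderiv ℝ (_root_.wirtingerDbar i F) z v = (fderiv ℝ (fderiv ℝ F) z v (coordVec i)
      + Complex.I * fderiv ℝ (fderiv ℝ F) z v (Complex.I • coordVec i)) / 2 := by
  have hd : DifferentiableAt ℝ (fderiv ℝ F) z :=
    (hF.fderiv_right (m := ∞) (by simp)).differentiableAt (by simp)
  have h1 (u : CModel n) :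
      HasFDerivAt (fun w => fderiv ℝ F w u) ((fderiv ℝ (fderiv ℝ F) z).flip u) z := by
    simpa using! hd.hasFDerivAt.clm_apply (hasFDerivAt_const u z)
  have h2 := (((h1 (coordVec i)).add ((h1 (Complex.I • coordVec i)).const_mul Complex.I)).mul_const
    (2⁻¹ : ℂ)).fderiv
  have h3 := DFunLike.congr_fun h2 v
  have h4 : _root_.wirtingerDbar i F = fun w => (fderiv ℝ F w (coordVec i)
      + Complex.I * fderiv ℝ F w (Complex.I • coordVec i)) * (2⁻¹ : ℂ) := by
    funext w
    simp only [_root_.wirtingerDbar, div_eq_mul_inv]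
  rw [h4]
  refine h3.trans ?_
  simp
  ring

/-- Both sides expand into values of the real second derivative, which is symmetric. -/
theorem wirtingerD_wirtingerDbar_comm (hF : ContDiffAt ℝ ∞ F z) (i j : Fin n) :
    wirtingerD i (wirtingerDbar j F) z = wirtingerDbar j (wirtingerD i F) z := by
  have hs : IsSymmSndFDerivAt ℝ F z := hF.isSymmSndFDerivAt (by
    rw [minSmoothness_of_isRCLikeNormedField]; exact WithTop.coe_le_coe.2 (le_top : (2 : ℕ∞) ≤ ⊤))
  rw [wirtingerD, wirtingerDbar]
  simp only [fderiv_wirtingerD hF, fderiv_wirtingerDbar hF]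
  rw [hs.eq (coordVec i) (coordVec j), hs.eq (coordVec i) (Complex.I • coordVec j),
    hs.eq (Complex.I • coordVec i) (coordVec j),
    hs.eq (Complex.I • coordVec i) (Complex.I • coordVec j)]
  ring

end Wirtinger

/-! ### Metric coefficients and tangent vectors in a chart. -/

section ChartFacts

variable {n : ℕ} {X : Type*} [TopologicalSpace X] [ChartedSpace (CModel n) X]

theorem CModel.sum_coordVec (u : CModel n) : u = ∑ k, u k • coordVec k := by
  ext i
  simp [coordVec, Finset.sum_apply, Pi.single_apply]

theorem HermitianMetric.inChart_eq_sum (h : HermitianMetric n X)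
    (e : OpenPartialHomeomorph X (CModel n)) (z u v : CModel n) :
    h.inChart e z u v = ∑ k, ∑ l, h.coeff e k l z * u k * conj (v l) := by
  conv_lhs => rw [CModel.sum_coordVec u, CModel.sum_coordVec v]
  simp only [map_sum, LinearMap.sum_apply, map_smulₛₗ, LinearMap.smul_apply, smul_eq_mul,
    RingHom.id_apply, Finset.mul_sum]
  refine (Finset.sum_comm).trans (Finset.sum_congr rfl fun k _ => Finset.sum_congr rfl fun l _ => ?_)
  simp only [HermitianMetric.coeff]
  ring

theorem HermitianMetric.conj_coeff (h : HermitianMetric n X)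
    (e : OpenPartialHomeomorph X (CModel n)) (k l : Fin n) (z : CModel n) :
    conj (h.coeff e k l z) = h.coeff e l k z :=
  h.inChart_conj_symm e z _ _

theorem HermitianMetric.contDiffAt_coeff (h : HermitianMetric n X)
    {e : OpenPartialHomeomorph X (CModel n)} (he : e ∈ atlas (CModel n) X) {z : CModel n}
    (hz : z ∈ e.target) (k l : Fin n) : ContDiffAt ℝ ∞ (h.coeff e k l) z :=
  (h.smooth e he (coordVec k) (coordVec l)).contDiffAt (e.open_target.mem_nhds hz)

theorem HermitianMetric.contDiffAt_inChart (h : HermitianMetric n X)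
    {e : OpenPartialHomeomorph X (CModel n)} (he : e ∈ atlas (CModel n) X) {z : CModel n}
    (hz : z ∈ e.target) (u v : CModel n) : ContDiffAt ℝ ∞ (fun w => h.inChart e w u v) z :=
  (h.smooth e he u v).contDiffAt (e.open_target.mem_nhds hz)

/-- All tangent spaces are definitionally `ℂⁿ`; this transports the form along `e.symm (e x) = x`,
which is only a propositional equality. -/
theorem HermitianMetric.form_congr (h : HermitianMetric n X) {x y : X} (hxy : y = x)
    (u v : CModel n) :
    h.form y (show TangentSpace 𝓘(ℂ, CModel n) y from u)
      (show TangentSpace 𝓘(ℂ, CModel n) y from v)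
    = h.form x (show TangentSpace 𝓘(ℂ, CModel n) x from u)
      (show TangentSpace 𝓘(ℂ, CModel n) x from v) := by
  subst hxy
  rfl

theorem HermitianMetric.conj_invCoeff (h : HermitianMetric n X)
    {e : OpenPartialHomeomorph X (CModel n)} (p q : Fin n) (z : CModel n) :
    conj (h.invCoeff e p q z) = h.invCoeff e q p z := by
  have hM : (Matrix.of fun k l => h.coeff e k l z).IsHermitian := by
    ext k l
    exact h.conj_coeff e l k z
  exact hM.inv.apply p q

variable [IsManifold 𝓘(ℂ, CModel n) ω X]

theorem mdifferentiable_of_mem_atlas_complex {e : OpenPartialHomeomorph X (CModel n)}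
    (he : e ∈ atlas (CModel n) X) : e.MDifferentiable 𝓘(ℂ, CModel n) 𝓘(ℂ, CModel n) := by
  have : IsManifold 𝓘(ℂ, CModel n) 1 X := IsManifold.of_le (n := ω) le_top
  exact mdifferentiable_of_mem_atlas he

theorem coordField_injective {e : OpenPartialHomeomorph X (CModel n)}
    (he : e ∈ atlas (CModel n) X) {z : CModel n} (hz : z ∈ e.target) :
    Function.Injective (coordField e z) :=
  (mdifferentiable_of_mem_atlas_complex he).symm.mfderiv_injective hz

theorem coordField_tangentCoord {e : OpenPartialHomeomorph X (CModel n)}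
    (he : e ∈ atlas (CModel n) X) {x : X} (hx : x ∈ e.source)
    (u : TangentSpace 𝓘(ℂ, CModel n) x) :
    coordField e (e x) (tangentCoord e x u) = (u : CModel n) :=
  DFunLike.congr_fun ((mdifferentiable_of_mem_atlas_complex he).symm_comp_deriv hx) u

theorem tangentCoord_injective {e : OpenPartialHomeomorph X (CModel n)}
    (he : e ∈ atlas (CModel n) X) {x : X} (hx : x ∈ e.source) :
    Function.Injective (tangentCoord e x) :=
  (mdifferentiable_of_mem_atlas_complex he).mfderiv_injective hx

theorem HermitianMetric.inChart_tangentCoord (h : HermitianMetric n X)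
    {e : OpenPartialHomeomorph X (CModel n)}
    (he : e ∈ atlas (CModel n) X) {x : X} (hx : x ∈ e.source)
    (u v : TangentSpace 𝓘(ℂ, CModel n) x) :
    h.inChart e (e x) (tangentCoord e x u) (tangentCoord e x v) = h.form x u v := by
  change h.form (e.symm (e x)) (coordField e (e x) (tangentCoord e x u))
    (coordField e (e x) (tangentCoord e x v)) = _
  rw [coordField_tangentCoord he hx, coordField_tangentCoord he hx]
  exact h.form_congr (e.left_inv hx) u v

theorem HermitianMetric.inChart_self_pos (h : HermitianMetric n X)
    {e : OpenPartialHomeomorph X (CModel n)}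
    (he : e ∈ atlas (CModel n) X) {z : CModel n} (hz : z ∈ e.target) {u : CModel n} (hu : u ≠ 0) :
    0 < (h.inChart e z u u).re :=
  h.pos _ _ fun h0 => hu (coordField_injective he hz (h0.trans (map_zero _).symm))

/-- A null vector of the coefficient matrix would be a nonzero `u` with `h(u, u) = 0`. -/
theorem HermitianMetric.isUnit_det_coeff (h : HermitianMetric n X)
    {e : OpenPartialHomeomorph X (CModel n)}
    (he : e ∈ atlas (CModel n) X) {z : CModel n} (hz : z ∈ e.target) :
    IsUnit (Matrix.of fun k l => h.coeff e k l z).det := by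
  rw [isUnit_iff_ne_zero]
  intro h0
  obtain ⟨v, hv0, hv⟩ := Matrix.exists_vecMul_eq_zero_iff.2 h0
  let u : CModel n := WithLp.toLp 2 v
  have hu : u ≠ 0 := fun hu => hv0 (by simpa [u] using hu)
  refine (h.inChart_self_pos he hz hu).ne' ?_
  rw [h.inChart_eq_sum, Finset.sum_comm]
  have : ∀ l, ∑ k, h.coeff e k l z * u k * conj (u l) = 0 := by
    intro l
    have := congr_fun hv l
    simp only [Matrix.vecMul, dotProduct, Matrix.of_apply, Pi.zero_apply] at this
    rw [← Finset.sum_mul]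
    simp only [u, mul_comm (h.coeff e _ l z)]
    rw [this, zero_mul]
  simp [this]

theorem HermitianMetric.sum_invCoeff_mul_coeff (h : HermitianMetric n X)
    {e : OpenPartialHomeomorph X (CModel n)}
    (he : e ∈ atlas (CModel n) X) {z : CModel n} (hz : z ∈ e.target) (p k : Fin n) :
    ∑ q, h.invCoeff e p q z * h.coeff e k q z = if p = k then 1 else 0 := by
  have := congr_fun₂ (Matrix.mul_nonsing_inv _ (h.isUnit_det_coeff he hz)) k p
  rw [Matrix.mul_apply, Matrix.one_apply] at this
  simp only [HermitianMetric.invCoeff, eq_comm (a := p)]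
  rw [← this]
  exact Finset.sum_congr rfl fun q _ => mul_comm _ _

theorem HermitianMetric.sum_invCoeff_mul_coeff' (h : HermitianMetric n X)
    {e : OpenPartialHomeomorph X (CModel n)}
    (he : e ∈ atlas (CModel n) X) {z : CModel n} (hz : z ∈ e.target) (q l : Fin n) :
    ∑ p, h.invCoeff e p q z * h.coeff e p l z = if q = l then 1 else 0 := by
  have := congr_fun₂ (Matrix.nonsing_inv_mul _ (h.isUnit_det_coeff he hz)) q l
  rwa [Matrix.mul_apply, Matrix.one_apply] at this

end ChartFacts

/-! ### Chern curvature under a conformal change. -/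

section Conformal

variable {n : ℕ} {X : Type*} [TopologicalSpace X] [ChartedSpace (CModel n) X]

/-- A real function on `X` in the chart `e`, as a complex valued function on `ℂⁿ`. -/
noncomputable def inChartFun (φ : C^∞⟮𝓘(ℝ, CModel n), X; ℝ⟯) (e : OpenPartialHomeomorph X (CModel n))
    (w : CModel n) : ℂ :=
  (φ (e.symm w) : ℂ)

/-- The complex Hessian `∂²φ/∂zⁱ∂z̄ʲ` in the chart `e`. -/
noncomputable def levi (φ : C^∞⟮𝓘(ℝ, CModel n), X; ℝ⟯) (e : OpenPartialHomeomorph X (CModel n))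
    (i j : Fin n) (z : CModel n) : ℂ :=
  wirtingerD i (wirtingerDbar j (inChartFun φ e)) z

variable [IsManifold 𝓘(ℂ, CModel n) ω X]
  {e : OpenPartialHomeomorph X (CModel n)} {z : CModel n}

theorem contDiffAt_inChartFun (φ : C^∞⟮𝓘(ℝ, CModel n), X; ℝ⟯) (he : e ∈ atlas (CModel n) X)
    (hz : z ∈ e.target) : ContDiffAt ℝ ∞ (inChartFun φ e) z := by
  have : IsManifold 𝓘(ℝ, CModel n) ∞ X := isManifold_real n X
  have h1 : ContMDiffOn 𝓘(ℝ, CModel n) 𝓘(ℝ, CModel n) ∞ e.symm e.target :=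
    contMDiffOn_symm_of_mem_maximalAtlas (IsManifold.subset_maximalAtlas he)
  have h2 : ContDiffOn ℝ ∞ (fun z => φ (e.symm z)) e.target :=
    (φ.contMDiff.comp_contMDiffOn h1).contDiffOn
  exact (Complex.ofRealCLM.contDiff.comp_contDiffOn h2).contDiffAt (e.open_target.mem_nhds hz)

/-- Conjugation swaps the two Wirtinger operators, which commute, and fixes the real function `φ`.
-/
theorem conj_levi (φ : C^∞⟮𝓘(ℝ, CModel n), X; ℝ⟯) (he : e ∈ atlas (CModel n) X)
    (hz : z ∈ e.target) (i j : Fin n) : conj (levi φ e i j z) = levi φ e j i z := by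
  have hF := contDiffAt_inChartFun φ he hz
  rw [levi, conj_wirtingerD i (hF.wirtingerDbar j).real_differentiableAt, levi,
    wirtingerD_wirtingerDbar_comm hF]
  refine wirtingerDbar_congr i ?_
  filter_upwards [e.open_target.mem_nhds hz] with w hw
  rw [conj_wirtingerDbar j (contDiffAt_inChartFun φ he hw).real_differentiableAt]
  congr 1
  funext w
  exact Complex.conj_ofReal _

theorem levi_smul (c : ℝ) (φ : C^∞⟮𝓘(ℝ, CModel n), X; ℝ⟯) (he : e ∈ atlas (CModel n) X)
    (hz : z ∈ e.target) (i j : Fin n) : levi (c • φ) e i j z = c * levi φ e i j z := by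
  have h0 : inChartFun (c • φ) e = fun w => (c : ℂ) * inChartFun φ e w := by
    funext w
    exact Complex.ofReal_mul _ _
  have hF := contDiffAt_inChartFun φ he hz
  rw [levi, h0, wirtingerD_congr (G := fun w => (c : ℂ) * wirtingerDbar j (inChartFun φ e) w),
    wirtingerD_const_mul i _ (hF.wirtingerDbar j).real_differentiableAt, levi]
  filter_upwards [e.open_target.mem_nhds hz] with w hw
  exact wirtingerDbar_const_mul j _ (contDiffAt_inChartFun φ he hw).real_differentiableAt

theorem coeff_expMul (h : HermitianMetric n X) (φ : C^∞⟮𝓘(ℝ, CModel n), X; ℝ⟯)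
    (e : OpenPartialHomeomorph X (CModel n)) (k l : Fin n) :
    (h.expMul φ).coeff e k l = fun w => Complex.exp (inChartFun φ e w) * h.coeff e k l w := by
  funext w
  change (Real.exp _ : ℂ) * _ = _
  rw [Complex.ofReal_exp]
  rfl

theorem invCoeff_expMul (h : HermitianMetric n X) (φ : C^∞⟮𝓘(ℝ, CModel n), X; ℝ⟯)
    (he : e ∈ atlas (CModel n) X) (hz : z ∈ e.target) (p q : Fin n) :
    (h.expMul φ).invCoeff e p q z
      = (Complex.exp (inChartFun φ e z))⁻¹ * h.invCoeff e p q z := by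
  have h1 : (Matrix.of fun k l => (h.expMul φ).coeff e k l z)
      = Complex.exp (inChartFun φ e z) • Matrix.of fun k l => h.coeff e k l z := by
    ext k l
    simp [coeff_expMul]
  let u : ℂˣ := Units.mk0 _ (Complex.exp_ne_zero (inChartFun φ e z))
  rw [HermitianMetric.invCoeff, h1]
  have h2 := congr_fun₂ (Matrix.inv_smul' (A := Matrix.of fun k l => h.coeff e k l z) u
    (h.isUnit_det_coeff he hz)) q p
  simpa [u, Units.smul_def] using! h2

theorem wirtingerD_coeff_expMul (h : HermitianMetric n X) (φ : C^∞⟮𝓘(ℝ, CModel n), X; ℝ⟯)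
    (he : e ∈ atlas (CModel n) X) (hz : z ∈ e.target) (i k l : Fin n) :
    wirtingerD i ((h.expMul φ).coeff e k l) z = Complex.exp (inChartFun φ e z) *
      (wirtingerD i (inChartFun φ e) z * h.coeff e k l z + wirtingerD i (h.coeff e k l) z) := by
  have hF := (contDiffAt_inChartFun φ he hz).real_differentiableAt
  rw [coeff_expMul, wirtingerD_mul i hF.cexp (h.contDiffAt_coeff he hz k l).real_differentiableAt,
    wirtingerD_exp i hF]
  ring

theorem wirtingerDbar_coeff_expMul (h : HermitianMetric n X) (φ : C^∞⟮𝓘(ℝ, CModel n), X; ℝ⟯)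
    (he : e ∈ atlas (CModel n) X) (hz : z ∈ e.target) (i k l : Fin n) :
    wirtingerDbar i ((h.expMul φ).coeff e k l) z = Complex.exp (inChartFun φ e z) *
      (wirtingerDbar i (inChartFun φ e) z * h.coeff e k l z
        + wirtingerDbar i (h.coeff e k l) z) := by
  have hF := (contDiffAt_inChartFun φ he hz).real_differentiableAt
  rw [coeff_expMul, wirtingerDbar_mul i hF.cexp
    (h.contDiffAt_coeff he hz k l).real_differentiableAt, wirtingerDbar_exp i hF]
  ring

theorem wirtingerD_wirtingerDbar_coeff_expMul (h : HermitianMetric n X)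
    (φ : C^∞⟮𝓘(ℝ, CModel n), X; ℝ⟯)
    (he : e ∈ atlas (CModel n) X) (hz : z ∈ e.target) (i j k l : Fin n) :
    wirtingerD i (wirtingerDbar j ((h.expMul φ).coeff e k l)) z = Complex.exp (inChartFun φ e z) *
      (wirtingerD i (inChartFun φ e) z * (wirtingerDbar j (inChartFun φ e) z * h.coeff e k l z
        + wirtingerDbar j (h.coeff e k l) z) + levi φ e i j z * h.coeff e k l z
        + wirtingerDbar j (inChartFun φ e) z * wirtingerD i (h.coeff e k l) z
        + wirtingerD i (wirtingerDbar j (h.coeff e k l)) z) := by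
  have hF := contDiffAt_inChartFun φ he hz
  have hc := h.contDiffAt_coeff he hz k l
  have hFd := hF.real_differentiableAt
  have hFj := (hF.wirtingerDbar j).real_differentiableAt
  have hcj := (hc.wirtingerDbar j).real_differentiableAt
  have hcd := hc.real_differentiableAt
  rw [wirtingerD_congr (G := fun w => Complex.exp (inChartFun φ e w) *
      (wirtingerDbar j (inChartFun φ e) w * h.coeff e k l w + wirtingerDbar j (h.coeff e k l) w)),
    wirtingerD_mul i hFd.cexp ((hFj.fun_mul hcd).fun_add hcj), wirtingerD_add i (hFj.fun_mul hcd) hcj,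
    wirtingerD_mul i hFj hcd, wirtingerD_exp i hFd, levi]
  · ring
  · filter_upwards [e.open_target.mem_nhds hz] with w hw
    exact wirtingerDbar_coeff_expMul h φ he hw j k l

/-- The Chern curvature of a conformal metric: `R(e^φ h) = e^φ (R(h) - ∂∂̄φ ⊗ h)`. -/
theorem curvCoeff_expMul (h : HermitianMetric n X) (φ : C^∞⟮𝓘(ℝ, CModel n), X; ℝ⟯)
    (he : e ∈ atlas (CModel n) X) (hz : z ∈ e.target) (i j k l : Fin n) :
    (h.expMul φ).curvCoeff e i j k l z = Complex.exp (inChartFun φ e z) *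
      (h.curvCoeff e i j k l z - levi φ e i j z * h.coeff e k l z) := by
  set E := Complex.exp (inChartFun φ e z) with hE
  have hE0 : E ≠ 0 := Complex.exp_ne_zero _
  set Fi := wirtingerD i (inChartFun φ e) z with hFi
  set Fj := wirtingerDbar j (inChartFun φ e) z with hFj
  -- Contracting with the inverse metric collapses every term containing a derivative of `φ`. The
  -- results cancel the first-order terms of `∂∂̄(e^φ h)`, leaving only `∂∂̄φ ⊗ h`.
  have key : ∑ p, ∑ q, (h.expMul φ).invCoeff e p q z * wirtingerD i ((h.expMul φ).coeff e k q) z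
        * wirtingerDbar j ((h.expMul φ).coeff e p l) z
      = E * (Fi * Fj * h.coeff e k l z + Fj * wirtingerD i (h.coeff e k l) z
        + Fi * wirtingerDbar j (h.coeff e k l) z + ∑ p, ∑ q, h.invCoeff e p q z *
          wirtingerD i (h.coeff e k q) z * wirtingerDbar j (h.coeff e p l) z) := by
    have h1 : ∀ p q, (h.expMul φ).invCoeff e p q z * wirtingerD i ((h.expMul φ).coeff e k q) z
        * wirtingerDbar j ((h.expMul φ).coeff e p l) z
        = E * (Fi * (Fj * h.coeff e p l z + wirtingerDbar j (h.coeff e p l) z)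
              * (h.invCoeff e p q z * h.coeff e k q z)
            + Fj * (wirtingerD i (h.coeff e k q) z * (h.invCoeff e p q z * h.coeff e p l z))
            + h.invCoeff e p q z *
          wirtingerD i (h.coeff e k q) z * wirtingerDbar j (h.coeff e p l) z) := by
      intro p q
      rw [invCoeff_expMul h φ he hz, wirtingerD_coeff_expMul h φ he hz,
        wirtingerDbar_coeff_expMul h φ he hz]
      simp only [← hE, ← hFi, ← hFj]
      field_simp
      ring
    simp only [h1]
    simp only [← Finset.mul_sum, Finset.sum_add_distrib]
    congr 2
    have h2 : ∑ p, ∑ q, wirtingerD i (h.coeff e k q) z * (h.invCoeff e p q z * h.coeff e p l z)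
        = wirtingerD i (h.coeff e k l) z := by
      rw [Finset.sum_comm]
      simp only [← Finset.mul_sum, h.sum_invCoeff_mul_coeff' he hz]
      simp
    rw [h2]
    simp only [h.sum_invCoeff_mul_coeff he hz]
    simp
    ring
  rw [HermitianMetric.curvCoeff, key, wirtingerD_wirtingerDbar_coeff_expMul h φ he hz,
    HermitianMetric.curvCoeff]
  ring

end Conformal

/-! ### Symmetries of the curvature of a Kähler metric. -/

section Kahler

/-- In finite dimension an alternating map is a linear function of its values on tuples of basis
vectors. Needed because evaluating `extDeriv` requires differentiability of the form itself, while
metrics are smooth only coefficientwise. -/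
theorem differentiableAt_continuousAlternatingMap {E F ι : Type*} [NormedAddCommGroup E]
    [NormedSpace ℝ E] [FiniteDimensional ℝ E] [NormedAddCommGroup F] [NormedSpace ℝ F]
    [Fintype ι] {α : F → E [⋀^ι]→L[ℝ] ℝ} {z : F}
    (h : ∀ m, DifferentiableAt ℝ (fun w => α w m) z) : DifferentiableAt ℝ α z := by
  classical
  let b := Module.finBasis ℝ E
  let L : (E [⋀^ι]→L[ℝ] ℝ) →ₗ[ℝ] ((ι → Fin (Module.finrank ℝ E)) → ℝ) :=
    { toFun := fun β s => β fun i => b (s i)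
      map_add' := fun _ _ => rfl
      map_smul' := fun _ _ => rfl }
  have hL : LinearMap.ker L = ⊥ := by
    rw [LinearMap.ker_eq_bot]
    intro β γ hβγ
    apply ContinuousAlternatingMap.toAlternatingMap_injective
    exact b.ext_alternating fun s _ => congr_fun hβγ s
  obtain ⟨g, hg⟩ := L.exists_leftInverse_of_injective hL
  have h1 : α = fun w => g.toContinuousLinearMap (L (α w)) :=
    funext fun w => (DFunLike.congr_fun hg (α w)).symm
  rw [h1]
  exact g.toContinuousLinearMap.differentiableAt.comp z
    (differentiableAt_pi.2 fun s => h fun i => b (s i))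

variable {n : ℕ} {X : Type*} [TopologicalSpace X] [ChartedSpace (CModel n) X]
  {e : OpenPartialHomeomorph X (CModel n)} {z : CModel n}

theorem HermitianMetric.IsKahler.fderiv_cyclic {g : HermitianMetric n X} (hg : g.IsKahler)
    (he : e ∈ atlas (CModel n) X) (hz : z ∈ e.target) (a b c : CModel n) :
    (fderiv ℝ (fun w => g.inChart e w b c) z a).im
      - (fderiv ℝ (fun w => g.inChart e w a c) z b).im
      + (fderiv ℝ (fun w => g.inChart e w a b) z c).im = 0 := by
  have hd (u v : CModel n) : DifferentiableAt ℝ (fun w => g.inChart e w u v) z :=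
    (g.contDiffAt_inChart he hz u v).real_differentiableAt
  have him (u v : CModel n) : HasFDerivAt (fun w => -(g.inChart e w u v).im)
      (-(Complex.imCLM ∘L fderiv ℝ (fun w => g.inChart e w u v) z)) z :=
    (Complex.imCLM.hasFDerivAt.comp z (hd u v).hasFDerivAt).neg
  have hdiff : DifferentiableAt ℝ (g.kahlerForm e) z :=
    differentiableAt_continuousAlternatingMap fun m => (him (m 0) (m 1)).differentiableAt
  have hev (m : Fin 2 → CModel n) (v : CModel n) : fderiv ℝ (fun w => g.kahlerForm e w m) z v
      = -(fderiv ℝ (fun w => g.inChart e w (m 0) (m 1)) z v).im :=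
    DFunLike.congr_fun (him (m 0) (m 1)).fderiv v
  have h0 := DFunLike.congr_fun (hg e he z hz) ![a, b, c]
  rw [extDeriv_apply hdiff] at h0
  replace h0 := (Fin.sum_univ_three (M := ℝ) _).symm.trans h0
  simp only [hev] at h0
  simp [Fin.removeNth, Fin.succAbove] at h0
  linarith

/-- This is the vanishing of the (2,1)-part of `dω`, extracted from the real identity `dω = 0`. -/
theorem HermitianMetric.IsKahler.wirtingerD_coeff_comm {g : HermitianMetric n X} (hg : g.IsKahler)
    (he : e ∈ atlas (CModel n) X) (hz : z ∈ e.target) (i k l : Fin n) :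
    wirtingerD i (g.coeff e k l) z = wirtingerD k (g.coeff e i l) z := by
  have hd (u v : CModel n) : DifferentiableAt ℝ (fun w => g.inChart e w u v) z :=
    (g.contDiffAt_inChart he hz u v).real_differentiableAt
  let S : CModel n → CModel n → CModel n → ℂ := fun a b c =>
    fderiv ℝ (fun w => g.inChart e w b c) z a
  have hI2 (a b c : CModel n) : S a (Complex.I • b) c = Complex.I * S a b c := by
    simp only [S, map_smul, LinearMap.smul_apply, smul_eq_mul]
    rw [fderiv_const_mul (hd b c)]
    rfl
  have hI3 (a b c : CModel n) : S a b (Complex.I • c) = -Complex.I * S a b c := by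
    simp only [S, map_smulₛₗ, Complex.conj_I, smul_eq_mul]
    rw [fderiv_const_mul (hd b c)]
    rfl
  have hconj (a b c : CModel n) : conj (S a b c) = S a c b := by
    simp only [S]
    rw [← fderiv_conj_apply a (hd b c)]
    simp only [g.inChart_conj_symm]
  -- Multiplying the closedness identity by `2i` turns each imaginary part into `S - conj S`, and
  -- `hconj` removes the conjugates.
  have hK (a b c : CModel n) : S a b c - S a c b - (S b a c - S b c a) + S c a b - S c b a = 0 := by
    have h0 := hg.fderiv_cyclic he hz a b c
    have him (u : ℂ) : u - conj u = 2 * (u.im : ℂ) * Complex.I := by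
      rw [Complex.sub_conj]; push_cast; ring
    have h1 := him (S a b c)
    have h2 := him (S b a c)
    have h3 := him (S c a b)
    rw [hconj] at h1 h2 h3
    have h4 : ((S a b c).im : ℂ) - (S b a c).im + (S c a b).im = 0 := by exact_mod_cast h0
    linear_combination h1 - h2 + h3 + 2 * Complex.I * h4
  have hnn (c : CModel n) : Complex.I • Complex.I • c = - c := by
    rw [smul_smul, Complex.I_mul_I, neg_one_smul]
  let J : CModel n → CModel n := fun v => Complex.I • v
  have goal (a b c : CModel n) : S a b c - Complex.I * S (J a) b c
      = S b a c - Complex.I * S (J b) a c := by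
    have k1 := hK a b c
    have k2 := hK (J a) b c
    have k3 := hK a (J b) c
    have k4 := hK a b (J c)
    have k5 := hK (J a) (J b) c
    have k6 := hK (J a) b (J c)
    have k7 := hK a (J b) (J c)
    have k8 := hK (J a) (J b) (J c)
    simp only [J, hI2, hI3] at k1 k2 k3 k4 k5 k6 k7 k8 ⊢
    -- The coefficients expand `(1 - iJ_a)(1 - iJ_b)(1 + iJ_c)`, the projection to type (1,0) in
    -- `a`, `b` and (0,1) in `c`, up to a factor.
    linear_combination (norm := skip) (1 / 4 : ℂ) * (k1 - Complex.I * k2 - Complex.I * k3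
      + Complex.I * k4 - k5 + k6 + k7 - Complex.I * k8)
    ring_nf
    simp only [Complex.I_sq, Complex.I_pow_three]
    ring
  have := goal (coordVec i) (coordVec k) (coordVec l)
  simp only [S, J] at this
  simp only [wirtingerD]
  unfold HermitianMetric.coeff
  rw [this]

theorem HermitianMetric.conj_curvCoeff (g : HermitianMetric n X)
    (he : e ∈ atlas (CModel n) X) (hz : z ∈ e.target) (i j k l : Fin n) :
    conj (g.curvCoeff e i j k l z) = g.curvCoeff e j i l k z := by
  have hD {w : CModel n} (hw : w ∈ e.target) (i k l : Fin n) :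
      conj (wirtingerD i (g.coeff e k l) w) = wirtingerDbar i (g.coeff e l k) w := by
    rw [conj_wirtingerD i (g.contDiffAt_coeff he hw k l).real_differentiableAt]
    exact congrArg (wirtingerDbar i · w) (funext fun w => g.conj_coeff e k l w)
  have hDbar {w : CModel n} (hw : w ∈ e.target) (i k l : Fin n) :
      conj (wirtingerDbar i (g.coeff e k l) w) = wirtingerD i (g.coeff e l k) w := by
    rw [← hD hw, Complex.conj_conj]
  have h1 : conj (wirtingerD i (wirtingerDbar j (g.coeff e k l)) z)
      = wirtingerD j (wirtingerDbar i (g.coeff e l k)) z := by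
    rw [conj_wirtingerD i ((g.contDiffAt_coeff he hz k l).wirtingerDbar j).real_differentiableAt,
      wirtingerD_wirtingerDbar_comm (g.contDiffAt_coeff he hz l k)]
    refine wirtingerDbar_congr i ?_
    filter_upwards [e.open_target.mem_nhds hz] with w hw
    exact hDbar hw j k l
  rw [HermitianMetric.curvCoeff, HermitianMetric.curvCoeff, map_add, map_neg, h1]
  congr 1
  simp only [map_sum, map_mul, hD hz, hDbar hz, g.conj_invCoeff]
  rw [Finset.sum_comm]
  refine Finset.sum_congr rfl fun p _ => Finset.sum_congr rfl fun q _ => ?_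
  ring

/-- The index `k` enters the curvature only through `∂ᵢ h_{k·}`, once the two Wirtinger operators
are commuted in the second-order term. -/
theorem HermitianMetric.IsKahler.curvCoeff_comm {g : HermitianMetric n X} (hg : g.IsKahler)
    (he : e ∈ atlas (CModel n) X) (hz : z ∈ e.target) (i j k l : Fin n) :
    g.curvCoeff e i j k l z = g.curvCoeff e k j i l z := by
  have h1 : wirtingerD i (wirtingerDbar j (g.coeff e k l)) z
      = wirtingerD k (wirtingerDbar j (g.coeff e i l)) z := by
    rw [wirtingerD_wirtingerDbar_comm (g.contDiffAt_coeff he hz k l),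
      wirtingerD_wirtingerDbar_comm (g.contDiffAt_coeff he hz i l)]
    refine wirtingerDbar_congr j ?_
    filter_upwards [e.open_target.mem_nhds hz] with w hw
    exact hg.wirtingerD_coeff_comm he hw i k l
  rw [HermitianMetric.curvCoeff, HermitianMetric.curvCoeff, h1]
  simp only [hg.wirtingerD_coeff_comm he hz i k]

theorem HermitianMetric.IsKahler.curvCoeff_comm' {g : HermitianMetric n X} (hg : g.IsKahler)
    (he : e ∈ atlas (CModel n) X) (hz : z ∈ e.target) (i j k l : Fin n) :
    g.curvCoeff e i j k l z = g.curvCoeff e i l k j z := by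
  rw [← g.conj_curvCoeff he hz, hg.curvCoeff_comm he hz, g.conj_curvCoeff he hz]

end Kahler

/-! ### Averaging a symmetric quartic form over phases. -/

section Algebra

variable {n : ℕ}

/-- The sesquilinear form on `ℂⁿ` with coefficients `a i j`. -/
def sesqForm (a : Fin n → Fin n → ℂ) (u v : CModel n) : ℂ :=
  ∑ i, ∑ j, a i j * u i * conj (v j)

/-- The form on `ℂⁿ` with coefficients `a i j k l`, linear in the first and third and conjugate
linear in the second and fourth variable. -/
def quarticForm (a : Fin n → Fin n → Fin n → Fin n → ℂ) (u v w t : CModel n) : ℂ :=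
  ∑ i, ∑ j, ∑ k, ∑ l, a i j k l * u i * conj (v j) * w k * conj (t l)

section

variable (a : Fin n → Fin n → Fin n → Fin n → ℂ) (u u' v v' w w' t t' : CModel n) (c : ℂ)

theorem quarticForm_add₁ :
    quarticForm a (u + u') v w t = quarticForm a u v w t + quarticForm a u' v w t := by
  simp [quarticForm, mul_add, add_mul, Finset.sum_add_distrib]

theorem quarticForm_add₂ :
    quarticForm a u (v + v') w t = quarticForm a u v w t + quarticForm a u v' w t := by
  simp [quarticForm, mul_add, add_mul, Finset.sum_add_distrib]

theorem quarticForm_add₃ :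
    quarticForm a u v (w + w') t = quarticForm a u v w t + quarticForm a u v w' t := by
  simp [quarticForm, mul_add, add_mul, Finset.sum_add_distrib]

theorem quarticForm_add₄ :
    quarticForm a u v w (t + t') = quarticForm a u v w t + quarticForm a u v w t' := by
  simp [quarticForm, mul_add, Finset.sum_add_distrib]

theorem quarticForm_smul₁ : quarticForm a (c • u) v w t = c * quarticForm a u v w t := by
  simp only [quarticForm, Finset.mul_sum, PiLp.smul_apply, smul_eq_mul]
  congr! 4; ring

theorem quarticForm_smul₂ : quarticForm a u (c • v) w t = conj c * quarticForm a u v w t := by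
  simp only [quarticForm, Finset.mul_sum, PiLp.smul_apply, smul_eq_mul, map_mul]
  congr! 4; ring

theorem quarticForm_smul₃ : quarticForm a u v (c • w) t = c * quarticForm a u v w t := by
  simp only [quarticForm, Finset.mul_sum, PiLp.smul_apply, smul_eq_mul]
  congr! 4; ring

theorem quarticForm_smul₄ : quarticForm a u v w (c • t) = conj c * quarticForm a u v w t := by
  simp only [quarticForm, Finset.mul_sum, PiLp.smul_apply, smul_eq_mul, map_mul]
  congr! 4; ring

variable {a}

theorem quarticForm_comm₁₃ (h : ∀ i j k l, a i j k l = a k j i l) :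
    quarticForm a u v w t = quarticForm a w v u t := by
  have h1 : ∀ i j k l, a i j k l * u i * conj (v j) * w k * conj (t l)
      = a k j i l * w k * conj (v j) * u i * conj (t l) := fun i j k l => by rw [h i j k l]; ring
  simp only [quarticForm, h1]
  calc _ = ∑ j, ∑ i, ∑ k, ∑ l, a k j i l * w k * conj (v j) * u i * conj (t l) := Finset.sum_comm
    _ = ∑ j, ∑ k, ∑ i, ∑ l, a k j i l * w k * conj (v j) * u i * conj (t l) :=
      Finset.sum_congr rfl fun j _ => Finset.sum_comm
    _ = _ := Finset.sum_comm

theorem quarticForm_comm₂₄ (h : ∀ i j k l, a i j k l = a i l k j) :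
    quarticForm a u v w t = quarticForm a u t w v := by
  have h1 : ∀ i j k l, a i j k l * u i * conj (v j) * w k * conj (t l)
      = a i l k j * u i * conj (t l) * w k * conj (v j) := fun i j k l => by rw [h i j k l]; ring
  simp only [quarticForm, h1]
  refine Finset.sum_congr rfl fun i _ => ?_
  calc _ = ∑ k, ∑ j, ∑ l, a i l k j * u i * conj (t l) * w k * conj (v j) := Finset.sum_comm
    _ = ∑ k, ∑ l, ∑ j, a i l k j * u i * conj (t l) * w k * conj (v j) :=
      Finset.sum_congr rfl fun j _ => Finset.sum_comm
    _ = _ := Finset.sum_comm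

end

section

variable {a : Fin n → Fin n → Fin n → Fin n → ℂ}

theorem quarticForm_sum_phases₂ (w x k : CModel n) :
    quarticForm a (w + (1 : ℂ) • x) (w + (1 : ℂ) • x) k k
      + quarticForm a (w + (-1 : ℂ) • x) (w + (-1 : ℂ) • x) k k
      + quarticForm a (w + Complex.I • x) (w + Complex.I • x) k k
      + quarticForm a (w + (-Complex.I) • x) (w + (-Complex.I) • x) k k
    = 4 * (quarticForm a w w k k + quarticForm a x x k k) := by
  simp only [quarticForm_add₁, quarticForm_add₂, quarticForm_smul₁, quarticForm_smul₂, map_neg,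
    map_one, Complex.conj_I]
  linear_combination (-2 * quarticForm a x x k k) * Complex.I_sq

/-- In the expansion at `w + εx`, a monomial `ε^r ε̄^s` with `r ≠ s` has `|r - s| ≤ 2`, so it sums
to zero over the fourth roots of unity. The balanced mixed terms are four in number and coincide by
symmetry. -/
theorem quarticForm_sum_phases₄ (h₁₃ : ∀ i j k l, a i j k l = a k j i l)
    (h₂₄ : ∀ i j k l, a i j k l = a i l k j) (w x : CModel n) :
    quarticForm a (w + (1 : ℂ) • x) (w + (1 : ℂ) • x) (w + (1 : ℂ) • x) (w + (1 : ℂ) • x)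
      + quarticForm a (w + (-1 : ℂ) • x) (w + (-1 : ℂ) • x) (w + (-1 : ℂ) • x) (w + (-1 : ℂ) • x)
      + quarticForm a (w + Complex.I • x) (w + Complex.I • x) (w + Complex.I • x)
        (w + Complex.I • x)
      + quarticForm a (w + (-Complex.I) • x) (w + (-Complex.I) • x) (w + (-Complex.I) • x)
        (w + (-Complex.I) • x)
    = 4 * (quarticForm a w w w w + quarticForm a x x x x + 4 * quarticForm a w w x x) := by
  have e1 : quarticForm a x w w x = quarticForm a w w x x := quarticForm_comm₁₃ _ _ _ _ h₁₃
  have e2 : quarticForm a w x x w = quarticForm a w w x x := quarticForm_comm₂₄ _ _ _ _ h₂₄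
  have e3 : quarticForm a x x w w = quarticForm a w w x x :=
    (quarticForm_comm₁₃ _ _ _ _ h₁₃).trans e2
  simp only [quarticForm_add₁, quarticForm_add₂, quarticForm_add₃, quarticForm_add₄,
    quarticForm_smul₁, quarticForm_smul₂, quarticForm_smul₃, quarticForm_smul₄, map_neg, map_one,
    Complex.conj_I, e1, e2, e3]
  ring_nf
  simp only [Complex.I_sq, Complex.I_pow_four]
  ring

/-- The displayed expression is the average of the form on the diagonal over `w + ∑ εᵢ eᵢ`, each
`εᵢ` a fourth root of unity. The vector `w` is kept general so that the induction can absorb one `ε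
• e x` into it at a time. -/
theorem quarticForm_finset_pos {ι : Type*} [DecidableEq ι]
    (h₁₃ : ∀ i j k l, a i j k l = a k j i l)
    (h₂₄ : ∀ i j k l, a i j k l = a i l k j) (e : ι → CModel n) (s : Finset ι) :
    ∀ w : CModel n, (∀ c : ι → ℂ, (∀ i, c i ≠ 0) →
      0 < (quarticForm a (w + ∑ i ∈ s, c i • e i) (w + ∑ i ∈ s, c i • e i)
        (w + ∑ i ∈ s, c i • e i) (w + ∑ i ∈ s, c i • e i)).re) →
    0 < (quarticForm a w w w w + 4 * ∑ k ∈ s, quarticForm a w w (e k) (e k)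
      + 2 * ∑ i ∈ s, ∑ k ∈ s, quarticForm a (e i) (e i) (e k) (e k)
      - ∑ i ∈ s, quarticForm a (e i) (e i) (e i) (e i)).re := by
  induction s using Finset.induction_on with
  | empty =>
    intro w h
    simpa using h 1 (fun _ => one_ne_zero)
  | insert x s hx ih =>
    intro w h
    -- The coefficient at `x` is reset to `ε`; the other coefficients in `s` are unaffected since `x
    -- ∉ s`.
    have step : ∀ ε : ℂ, ε ≠ 0 → _ := fun ε hε => ih (w + ε • e x) fun c hc => by
      have := h (Function.update c x ε) fun i => by
        by_cases hi : i = x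
        · subst hi; simpa using hε
        · simpa [hi] using hc i
      have hs : ∑ i ∈ s, Function.update c x ε i • e i = ∑ i ∈ s, c i • e i :=
        Finset.sum_congr rfl fun i hi => by
          rw [Function.update_of_ne (ne_of_mem_of_not_mem hi hx)]
      rw [Finset.sum_insert hx, hs, Function.update_self, ← add_assoc] at this
      exact this
    have h4 := add_pos (add_pos (add_pos (step 1 one_ne_zero) (step (-1) (by simp)))
      (step Complex.I Complex.I_ne_zero)) (step (-Complex.I) (by simp))
    simp only [← Complex.add_re] at h4
    have e1 := quarticForm_sum_phases₄ h₁₃ h₂₄ w (e x)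
    have e2 : ∑ k ∈ s, _ = ∑ k ∈ s, _ :=
      Finset.sum_congr rfl fun k _ => quarticForm_sum_phases₂ (a := a) w (e x) (e k)
    simp only [Finset.sum_add_distrib, ← Finset.mul_sum] at e2
    have e3 : ∑ k ∈ s, quarticForm a (e k) (e k) (e x) (e x)
        = ∑ k ∈ s, quarticForm a (e x) (e x) (e k) (e k) := Finset.sum_congr rfl fun k _ =>
      (quarticForm_comm₁₃ _ _ _ _ h₁₃).trans (quarticForm_comm₂₄ _ _ _ _ h₂₄)
    refine pos_of_mul_pos_right (a := 4) ?_ (by norm_num)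
    rw [show (4 : ℝ) = ((4 : ℝ) : ℂ).re from rfl, ← Complex.re_ofReal_mul, Complex.ofReal_re]
    refine h4.trans_eq (congrArg Complex.re ?_)
    simp only [Finset.sum_insert hx, Finset.sum_add_distrib, e3]
    push_cast
    linear_combination e1 + 4 * e2

theorem sum_quarticForm_pos {ι : Type*} [Fintype ι] [Nonempty ι]
    (h₁₃ : ∀ i j k l, a i j k l = a k j i l) (h₂₄ : ∀ i j k l, a i j k l = a i l k j)
    (hpos : ∀ v, v ≠ 0 → 0 < (quarticForm a v v v v).re) {e : ι → CModel n}
    (he : LinearIndependent ℂ e) :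
    0 < ∑ i, ∑ k, (quarticForm a (e i) (e i) (e k) (e k)).re := by
  classical
  have h1 := quarticForm_finset_pos h₁₃ h₂₄ e Finset.univ 0 fun c hc => by
    rw [zero_add]
    refine hpos _ fun h0 => ?_
    exact hc (Classical.arbitrary ι) (Fintype.linearIndependent_iff.1 he c h0 _)
  have h2 : 0 < ∑ i, (quarticForm a (e i) (e i) (e i) (e i)).re :=
    Finset.sum_pos (fun i _ => hpos _ (he.ne_zero i)) Finset.univ_nonempty
  -- With `w = 0`, `h1` reads `2 ∑∑ - diagonal > 0`; adding the positive diagonal `h2` leaves twice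
  -- the double sum.
  have hz (w t : CModel n) : quarticForm a 0 0 w t = 0 := by simp [quarticForm]
  simp [hz] at h1
  linarith

end

end Algebra

/-! ### Products of sesquilinear forms, and traces over unitary bases. -/

section Algebra

variable {n : ℕ}

theorem quarticForm_sub (a b : Fin n → Fin n → Fin n → Fin n → ℂ) (u v w t : CModel n) :
    quarticForm (fun i j k l => a i j k l - b i j k l) u v w t
      = quarticForm a u v w t - quarticForm b u v w t := by
  simp [quarticForm, sub_mul, Finset.sum_sub_distrib]

theorem quarticForm_add (a b : Fin n → Fin n → Fin n → Fin n → ℂ) (u v w t : CModel n) :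
    quarticForm (fun i j k l => a i j k l + b i j k l) u v w t
      = quarticForm a u v w t + quarticForm b u v w t := by
  simp [quarticForm, add_mul, Finset.sum_add_distrib]

theorem quarticForm_const_mul (c : ℂ) (a : Fin n → Fin n → Fin n → Fin n → ℂ)
    (u v w t : CModel n) :
    quarticForm (fun i j k l => c * a i j k l) u v w t = c * quarticForm a u v w t := by
  simp only [quarticForm, Finset.mul_sum]
  congr! 4; ring

theorem quarticForm_mul (a b : Fin n → Fin n → ℂ) (u v w t : CModel n) :
    quarticForm (fun i j k l => a i j * b k l) u v w t = sesqForm a u v * sesqForm b w t := by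
  simp only [quarticForm, sesqForm, Finset.sum_mul]
  refine Finset.sum_congr rfl fun i _ => Finset.sum_congr rfl fun j _ => ?_
  simp only [Finset.mul_sum]
  congr! 2; ring

theorem quarticForm_mul_swap (a b : Fin n → Fin n → ℂ) (u v w t : CModel n) :
    quarticForm (fun i j k l => a i l * b k j) u v w t = sesqForm a u t * sesqForm b w v := by
  simp only [quarticForm, sesqForm, Finset.sum_mul]
  refine Finset.sum_congr rfl fun i _ => ?_
  have h1 : ∀ j, ∑ k, ∑ l, a i l * b k j * u i * conj (v j) * w k * conj (t l)
      = ∑ l, ∑ k, a i l * b k j * u i * conj (v j) * w k * conj (t l) :=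
    fun j => Finset.sum_comm
  simp only [h1]
  rw [Finset.sum_comm]
  refine Finset.sum_congr rfl fun l _ => ?_
  rw [Finset.sum_comm, Finset.mul_sum]
  simp only [Finset.mul_sum]
  congr! 2; ring

theorem conj_sesqForm {a : Fin n → Fin n → ℂ} (ha : ∀ i j, conj (a i j) = a j i)
    (u v : CModel n) : conj (sesqForm a u v) = sesqForm a v u := by
  simp only [sesqForm, map_sum, map_mul, ha, Complex.conj_conj]
  rw [Finset.sum_comm]
  congr! 2; ring

/-- The matrix `U` relating the two bases is unitary, and a trace is invariant under unitary change
of basis. -/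
theorem sum_apply_eq_of_unitary {E ι : Type*} [AddCommGroup E] [Module ℂ E] [Fintype ι]
    [DecidableEq ι] {S : Submodule ℂ E} (H Q : E →ₗ[ℂ] E →ₗ⋆[ℂ] ℂ) (b b' : Module.Basis ι ℂ S)
    (hb : ∀ i j, H (b i) (b j) = if i = j then 1 else 0)
    (hb' : ∀ i j, H (b' i) (b' j) = if i = j then 1 else 0) :
    ∑ i, Q (b i) (b i) = ∑ i, Q (b' i) (b' i) := by
  let U : Matrix ι ι ℂ := Matrix.of fun i j => b'.repr (b i) j
  have hU (i : ι) : (b i : E) = ∑ j, U i j • (b' j : E) := by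
    calc (b i : E) = ((∑ j, b'.repr (b i) j • b' j : S) : E) := by rw [b'.sum_repr]
      _ = _ := by rw [Submodule.coe_sum]; rfl
  have hexp (K : E →ₗ[ℂ] E →ₗ⋆[ℂ] ℂ) (i k : ι) :
      K (b i) (b k) = ∑ j, ∑ l, U i j * conj (U k l) * K (b' j) (b' l) := by
    rw [hU i, hU k]
    simp only [map_sum, LinearMap.sum_apply, map_smulₛₗ, LinearMap.smul_apply, smul_eq_mul,
      RingHom.id_apply, Finset.mul_sum]
    rw [Finset.sum_comm]
    congr! 2; ring
  have h1 : U * U.conjTranspose = 1 := by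
    ext i k
    rw [Matrix.one_apply, ← hb i k, hexp H i k, Matrix.mul_apply]
    simp [hb', Matrix.conjTranspose_apply]
  -- Unitarity of the bases gives orthonormal rows; the trace needs orthonormal columns.
  have h1' : U.conjTranspose * U = 1 := mul_eq_one_comm.1 h1
  have h2 : ∀ j l, ∑ i, U i j * conj (U i l) = if j = l then 1 else 0 := by
    intro j l
    have := congr_fun₂ h1' l j
    rw [Matrix.mul_apply, Matrix.one_apply] at this
    simp only [eq_comm (a := j)]
    rw [← this]
    exact Finset.sum_congr rfl fun i _ => mul_comm _ _
  simp only [hexp Q]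
  rw [Finset.sum_comm]
  refine Finset.sum_congr rfl fun j _ => ?_
  rw [Finset.sum_comm]
  simp only [← Finset.sum_mul, h2]
  simp

end Algebra

/-! ### Curvature on tangent vectors and the averaged inequality. -/

section Curvature

variable {n : ℕ} {X : Type*} [TopologicalSpace X] [ChartedSpace (CModel n) X]

/-- The coefficients of the Chern curvature in the preferred chart at `x`. -/
noncomputable def HermitianMetric.curvAt (h : HermitianMetric n X) (x : X)
    (i j k l : Fin n) : ℂ :=
  h.curvCoeff (chartAt (CModel n) x) i j k l (chartAt (CModel n) x x)

/-- The value `∂∂̄φ(v, v̄)` of the complex Hessian of `φ`. -/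
noncomputable def leviForm (φ : C^∞⟮𝓘(ℝ, CModel n), X; ℝ⟯) (x : X)
    (v : TangentSpace 𝓘(ℂ, CModel n) x) : ℝ :=
  (sesqForm (fun i j => levi φ (chartAt (CModel n) x) i j (chartAt (CModel n) x x))
    (tangentCoord (chartAt (CModel n) x) x v) (tangentCoord (chartAt (CModel n) x) x v)).re

theorem HermitianMetric.chernCurv_eq (h : HermitianMetric n X) (x : X)
    (v u : TangentSpace 𝓘(ℂ, CModel n) x) :
    h.chernCurv x v u = (quarticForm (h.curvAt x) (tangentCoord (chartAt (CModel n) x) x v)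
      (tangentCoord (chartAt (CModel n) x) x v) (tangentCoord (chartAt (CModel n) x) x u)
      (tangentCoord (chartAt (CModel n) x) x u)).re :=
  rfl

/-- The sesquilinear form `(u, u') ↦ R(v, v̄, u, ū')` of the Chern curvature. -/
noncomputable def HermitianMetric.chernForm (h : HermitianMetric n X) (x : X)
    (v : TangentSpace 𝓘(ℂ, CModel n) x) :
    TangentSpace 𝓘(ℂ, CModel n) x →ₗ[ℂ] TangentSpace 𝓘(ℂ, CModel n) x →ₗ⋆[ℂ] ℂ :=
  LinearMap.mk₂'ₛₗ (RingHom.id ℂ) (starRingEnd ℂ)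
    (fun u u' => quarticForm (h.curvAt x) (tangentCoord (chartAt (CModel n) x) x v)
      (tangentCoord (chartAt (CModel n) x) x v) (tangentCoord (chartAt (CModel n) x) x u)
      (tangentCoord (chartAt (CModel n) x) x u'))
    (fun u u' w => by rw [map_add]; exact quarticForm_add₃ _ _ _ _ _ _)
    (fun c u w => by rw [map_smul]; exact quarticForm_smul₃ _ _ _ _ _ _)
    (fun u w w' => by rw [map_add]; exact quarticForm_add₄ _ _ _ _ _ _)
    (fun c u w => by rw [map_smul]; exact quarticForm_smul₄ _ _ _ _ _ _)

theorem HermitianMetric.chernCurv_eq_chernForm (h : HermitianMetric n X) (x : X)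
    (v u : TangentSpace 𝓘(ℂ, CModel n) x) : h.chernCurv x v u = (h.chernForm x v u u).re :=
  rfl

theorem HermitianMetric.sum_chernCurv_eq_of_unitary {p : ℕ} (h : HermitianMetric n X) (x : X)
    (v : TangentSpace 𝓘(ℂ, CModel n) x) {S : Submodule ℂ (TangentSpace 𝓘(ℂ, CModel n) x)}
    (b b' : Module.Basis (Fin p) ℂ S)
    (hb : ∀ i j, h.form x (b i : TangentSpace 𝓘(ℂ, CModel n) x) (b j) = if i = j then 1 else 0)
    (hb' : ∀ i j,
      h.form x (b' i : TangentSpace 𝓘(ℂ, CModel n) x) (b' j) = if i = j then 1 else 0) :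
    ∑ i, h.chernCurv x v (b i) = ∑ i, h.chernCurv x v (b' i) := by
  simp only [h.chernCurv_eq_chernForm, ← Complex.re_sum]
  rw [sum_apply_eq_of_unitary (h.form x) (h.chernForm x v) b b' hb hb']

variable [IsManifold 𝓘(ℂ, CModel n) ω X]

theorem HermitianMetric.sesqForm_coeff (h : HermitianMetric n X) (x : X)
    (u v : TangentSpace 𝓘(ℂ, CModel n) x) :
    sesqForm (fun k l => h.coeff (chartAt (CModel n) x) k l (chartAt (CModel n) x x))
      (tangentCoord (chartAt (CModel n) x) x u) (tangentCoord (chartAt (CModel n) x) x v)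
      = h.form x u v := by
  rw [← h.inChart_tangentCoord (chart_mem_atlas _ x) (mem_chart_source _ x), h.inChart_eq_sum]
  rfl

theorem leviForm_smul (c : ℝ) (φ : C^∞⟮𝓘(ℝ, CModel n), X; ℝ⟯) (x : X)
    (v : TangentSpace 𝓘(ℂ, CModel n) x) : leviForm (c • φ) x v = c * leviForm φ x v := by
  simp only [leviForm, levi_smul c φ (chart_mem_atlas _ x) (mem_chart_target _ x),
    ← Complex.re_ofReal_mul]
  simp only [sesqForm, Finset.mul_sum, mul_assoc]

/-- The Hessian is Hermitian, hence real on the diagonal; this lets it leave the real part as a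
scalar factor in the conformal formula. -/
theorem sesqForm_levi_self (φ : C^∞⟮𝓘(ℝ, CModel n), X; ℝ⟯) (x : X)
    (v : TangentSpace 𝓘(ℂ, CModel n) x) :
    sesqForm (fun i j => levi φ (chartAt (CModel n) x) i j (chartAt (CModel n) x x))
      (tangentCoord (chartAt (CModel n) x) x v) (tangentCoord (chartAt (CModel n) x) x v)
      = leviForm φ x v :=
  (Complex.conj_eq_iff_re.1 (conj_sesqForm (fun i j =>
    conj_levi φ (chart_mem_atlas _ x) (mem_chart_target _ x) i j) _ _)).symm

theorem HermitianMetric.chernCurv_expMul (h : HermitianMetric n X)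
    (φ : C^∞⟮𝓘(ℝ, CModel n), X; ℝ⟯) (x : X) (v u : TangentSpace 𝓘(ℂ, CModel n) x) :
    (h.expMul φ).chernCurv x v u
      = Real.exp (φ x) * (h.chernCurv x v u - leviForm φ x v * (h.form x u u).re) := by
  have h1 : (h.expMul φ).curvAt x = fun i j k l => (Real.exp (φ x) : ℂ) * (h.curvAt x i j k l -
      levi φ (chartAt (CModel n) x) i j (chartAt (CModel n) x x)
        * h.coeff (chartAt (CModel n) x) k l (chartAt (CModel n) x x)) := by
    funext i j k l
    rw [HermitianMetric.curvAt, curvCoeff_expMul h φ (chart_mem_atlas _ x) (mem_chart_target _ x),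
      inChartFun, (chartAt (CModel n) x).left_inv (mem_chart_source _ x), Complex.ofReal_exp]
    rfl
  rw [HermitianMetric.chernCurv_eq, h1, quarticForm_const_mul, Complex.re_ofReal_mul,
    quarticForm_sub, Complex.sub_re, quarticForm_mul, sesqForm_levi_self, h.sesqForm_coeff,
    Complex.re_ofReal_mul, ← h.chernCurv_eq]

theorem HermitianMetric.IsKahler.sum_chernCurv_sub_pos {g : HermitianMetric n X} (hg : g.IsKahler)
    (f : C^∞⟮𝓘(ℝ, CModel n), X; ℝ⟯) {x : X}
    (hpos : ∀ v : TangentSpace 𝓘(ℂ, CModel n) x, v ≠ 0 →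
      0 < g.chernCurv x v v - 2 * leviForm f x v * (g.form x v v).re)
    {ι : Type*} [Fintype ι] [DecidableEq ι] [Nonempty ι]
    {b : ι → TangentSpace 𝓘(ℂ, CModel n) x} (hb : LinearIndependent ℂ b) {c : ℝ}
    (hc : ∀ i j, g.form x (b i) (b j) = if i = j then (c : ℂ) else 0) :
    0 < ∑ i, (∑ k, g.chernCurv x (b i) (b k) - (Fintype.card ι + 1) * c * leviForm f x (b i)) := by
  set e := chartAt (CModel n) x with he
  have hes : e ∈ atlas (CModel n) X := chart_mem_atlas _ x
  have hxs : x ∈ e.source := mem_chart_source _ x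
  have hxt : e x ∈ e.target := mem_chart_target _ x
  let L : Fin n → Fin n → ℂ := fun i j => levi f e i j (e x)
  let G : Fin n → Fin n → ℂ := fun i j => g.coeff e i j (e x)
  -- The four products symmetrize `2 L ⊗ G` over the slots; with weight `1/2` each, they give `2
  -- L(v,v) G(v,v)` on the diagonal.
  let a : Fin n → Fin n → Fin n → Fin n → ℂ := fun i j k l => g.curvAt x i j k l
    - (1 / 2 : ℂ) * ((L i j * G k l + G i j * L k l) + (L i l * G k j + G i l * L k j))
  have h₁₃ : ∀ i j k l, a i j k l = a k j i l := fun i j k l => by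
    simp only [a, HermitianMetric.curvAt, hg.curvCoeff_comm hes hxt i j k l, ← he]
    ring
  have h₂₄ : ∀ i j k l, a i j k l = a i l k j := fun i j k l => by
    simp only [a, HermitianMetric.curvAt, hg.curvCoeff_comm' hes hxt i j k l, ← he]
    ring
  have ha (u v : TangentSpace 𝓘(ℂ, CModel n) x) :
      quarticForm a (tangentCoord e x u) (tangentCoord e x u) (tangentCoord e x v)
        (tangentCoord e x v)
      = quarticForm (g.curvAt x) (tangentCoord e x u) (tangentCoord e x u) (tangentCoord e x v)
        (tangentCoord e x v) - (1 / 2 : ℂ) * ((leviForm f x u * g.form x v v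
          + g.form x u u * leviForm f x v)
        + (sesqForm L (tangentCoord e x u) (tangentCoord e x v) * g.form x v u
          + g.form x u v * sesqForm L (tangentCoord e x v) (tangentCoord e x u))) := by
    simp only [a, quarticForm_sub, quarticForm_const_mul, quarticForm_add, quarticForm_mul,
      quarticForm_mul_swap]
    simp only [L, G, he, g.sesqForm_coeff, sesqForm_levi_self]
  have hapos : ∀ V : CModel n, V ≠ 0 → 0 < (quarticForm a V V V V).re := by
    intro V hV
    obtain ⟨v, rfl⟩ := (mdifferentiable_of_mem_atlas_complex hes).mfderiv_surjective hxs V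
    have hv : v ≠ 0 := fun h0 => hV (by rw [h0]; exact map_zero _)
    refine (hpos v hv).trans_eq ?_
    rw [g.chernCurv_eq]
    change _ = (quarticForm a (tangentCoord e x v) (tangentCoord e x v) (tangentCoord e x v)
        (tangentCoord e x v)).re
    rw [ha, sesqForm_levi_self, Complex.sub_re, ← he]
    have : (1 / 2 : ℂ) * ((leviForm f x v * g.form x v v + g.form x v v * leviForm f x v)
        + (leviForm f x v * g.form x v v + g.form x v v * leviForm f x v))
        = ((2 * leviForm f x v : ℝ) : ℂ) * g.form x v v := by push_cast; ring
    rw [this, Complex.re_ofReal_mul]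
  have hli : LinearIndependent ℂ fun i => tangentCoord e x (b i) :=
    hb.map' (tangentCoord e x).toLinearMap (LinearMap.ker_eq_bot.2 (tangentCoord_injective hes hxs))
  refine (sum_quarticForm_pos h₁₃ h₂₄ hapos hli).trans_eq ?_
  -- By orthogonality the crossed products survive only for `i = k`. Summed over `i` and `k`, the
  -- straight products contribute `card ι` and the crossed ones `1` to the factor `card ι + 1`.
  have hterm (i k : ι) : (quarticForm a (tangentCoord e x (b i)) (tangentCoord e x (b i))
      (tangentCoord e x (b k)) (tangentCoord e x (b k))).re = g.chernCurv x (b i) (b k)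
      - 1 / 2 * c * (leviForm f x (b i) + leviForm f x (b k))
      - if i = k then c * leviForm f x (b i) else 0 := by
    rw [ha, g.chernCurv_eq, hc, hc, hc, hc, ← he]
    simp only [if_true]
    rw [Complex.sub_re, sub_sub]
    congr 1
    by_cases hik : i = k
    · subst hik
      simp only [if_true]
      rw [sesqForm_levi_self]
      norm_num
      ring
    · simp only [if_neg hik, if_neg (Ne.symm hik)]
      norm_num
      ring
  simp only [hterm]
  simp only [Finset.sum_sub_distrib, Finset.sum_ite_eq, Finset.mem_univ, if_true, ← Finset.mul_sum,
    Finset.sum_add_distrib, Finset.sum_const, Finset.card_univ, nsmul_eq_mul]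
  ring

end Curvature

/-! ### Unitary bases of subspaces, and the conclusion. -/

theorem exists_unitary_basis {E : Type*} [AddCommGroup E] [Module ℂ E] [FiniteDimensional ℂ E]
    (H : E → E → ℂ) (hadd : ∀ u v w, H (u + v) w = H u w + H v w)
    (hsmul : ∀ (c : ℂ) u v, H (c • u) v = c * H u v) (hconj : ∀ u v, conj (H v u) = H u v)
    (hpos : ∀ u, u ≠ 0 → 0 < (H u u).re) {p : ℕ} (hp : Module.finrank ℂ E = p) :
    ∃ b : Module.Basis (Fin p) ℂ E, ∀ i j, H (b i) (b j) = if i = j then 1 else 0 := by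
  have h0 : H 0 0 = 0 := by simpa using hsmul 0 0 0
  let core : InnerProductSpace.Core ℂ E :=
    -- The arguments are swapped because Mathlib's inner product is conjugate linear in its first
    -- variable.
    { inner := fun u v => H v u
      conj_inner_symm := fun u v => hconj v u
      re_inner_nonneg := fun u => by
        by_cases hu : u = 0
        · subst hu; simp [h0]
        · exact (hpos u hu).le
      add_left := fun u v w => by
        rw [← hconj w (u + v), hadd, map_add, hconj, hconj]
      smul_left := fun u v c => by
        rw [← hconj v (c • u), hsmul, map_mul, hconj]
      definite := fun u hu => by
        by_contra hne
        exact (hpos u hne).ne' (congrArg Complex.re hu) }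
  let _ : NormedAddCommGroup E := core.toNormedAddCommGroup
  let _ : InnerProductSpace ℂ E := InnerProductSpace.ofCore core.toCore
  let b := (stdOrthonormalBasis ℂ E).reindex (finCongr hp)
  refine ⟨b.toBasis, fun i j => ?_⟩
  have := orthonormal_iff_ite.1 b.orthonormal j i
  simp only [eq_comm (a := i)]
  rw [b.coe_toBasis]
  exact this

theorem HermitianMetric.exists_unitary_basis {n : ℕ} {X : Type*} [TopologicalSpace X]
    [ChartedSpace (CModel n) X] (h : HermitianMetric n X) (x : X)
    (S : Submodule ℂ (TangentSpace 𝓘(ℂ, CModel n) x)) {p : ℕ} (hp : Module.finrank ℂ S = p) :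
    ∃ b : Module.Basis (Fin p) ℂ S, ∀ i j,
      h.form x (b i : TangentSpace 𝓘(ℂ, CModel n) x) (b j) = if i = j then 1 else 0 := by
  have : FiniteDimensional ℂ (TangentSpace 𝓘(ℂ, CModel n) x) :=
    inferInstanceAs (FiniteDimensional ℂ (CModel n))
  exact _root_.exists_unitary_basis
    (fun u v : S => h.form x (u : TangentSpace 𝓘(ℂ, CModel n) x) v)
    (fun u v w => by simp) (fun c u v => by simp) (fun u v => h.conj_symm x u v)
    (fun u hu => h.pos x u fun h0 => hu (Subtype.ext h0)) hp

theorem proposition3p1 {n : ℕ} {X : Type*} [TopologicalSpace X] [T2Space X] [CompactSpace X]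
    [ChartedSpace (CModel n) X] [IsManifold 𝓘(ℂ, CModel n) ω X]
    (h : HermitianMetric n X) (hconf : h.IsConformallyKahler) (hpos : h.HasPositiveHSC) :
    (∀ p : ℕ, 1 ≤ p → TangentBundleBCPositive n X p) ∧
    (∀ f : C^∞⟮𝓘(ℝ, CModel n), X; ℝ⟯, (h.expMul ((-2 : ℝ) • f)).IsKahler →
      ∀ p : ℕ, 1 ≤ p →
        ((h.expMul ((-2 : ℝ) • f)).expMul ((((p : ℝ) + 1) / p) • f)).IsBCPositive p) := by
  have main : ∀ f : C^∞⟮𝓘(ℝ, CModel n), X; ℝ⟯, (h.expMul ((-2 : ℝ) • f)).IsKahler →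
      ∀ p : ℕ, 1 ≤ p →
        ((h.expMul ((-2 : ℝ) • f)).expMul ((((p : ℝ) + 1) / p) • f)).IsBCPositive p := by
    intro f hg p hp x S hS
    set g := h.expMul ((-2 : ℝ) • f) with hgdef
    set ψ := (((p : ℝ) + 1) / p) • f with hψ
    obtain ⟨b₀, hb₀⟩ := (g.expMul ψ).exists_unitary_basis x S hS
    have : Nonempty (Fin p) := ⟨⟨0, hp⟩⟩
    have hgpos (v : TangentSpace 𝓘(ℂ, CModel n) x) (hv : v ≠ 0) :
        0 < g.chernCurv x v v - 2 * leviForm f x v * (g.form x v v).re := by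
      have h1 : 0 < h.chernCurv x v v := by
        have h2 := hpos x v hv
        rw [HermitianMetric.holSecCurv] at h2
        exact (div_pos_iff_of_pos_right (pow_pos (h.pos x v hv) 2)).1 h2
      have h3 : (g.form x v v).re = Real.exp (((-2 : ℝ) • f) x) * (h.form x v v).re :=
        Complex.re_ofReal_mul _ _
      -- The conformal formula, read from `h` to `g` with `φ = -2f`, identifies the left-over
      -- expression with `e^{-2f} R^h(v,v̄,v,v̄)`.
      rw [h3, hgdef, h.chernCurv_expMul, leviForm_smul]
      refine (mul_pos (Real.exp_pos (((-2 : ℝ) • f) x)) h1).trans_eq ?_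
      ring
    -- `b₀` is unitary for `e^ψ g`, hence only orthogonal for `g`, with `c = e^{-ψ(x)}`.
    have hc (i j : Fin p) : g.form x (b₀ i : TangentSpace 𝓘(ℂ, CModel n) x) (b₀ j)
        = if i = j then (((Real.exp (ψ x))⁻¹ : ℝ) : ℂ) else 0 := by
      have h1 : (Real.exp (ψ x) : ℂ) * g.form x (b₀ i : TangentSpace 𝓘(ℂ, CModel n) x) (b₀ j)
          = if i = j then 1 else 0 := hb₀ i j
      have h2 : (Real.exp (ψ x) : ℂ) ≠ 0 := by exact_mod_cast (Real.exp_pos (ψ x)).ne'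
      rw [eq_comm, Complex.ofReal_inv]
      refine mul_left_cancel₀ h2 ?_
      rw [h1]
      split_ifs
      · exact mul_inv_cancel₀ h2
      · exact mul_zero _
    have hli : LinearIndependent ℂ fun i => (b₀ i : TangentSpace 𝓘(ℂ, CModel n) x) :=
      b₀.linearIndependent.map' S.subtype S.ker_subtype
    have hsum := hg.sum_chernCurv_sub_pos f hgpos hli hc
    obtain ⟨i, -, hi⟩ := Finset.exists_lt_of_sum_lt (Finset.sum_const_zero.trans_lt hsum)
    -- The vector comes from the auxiliary basis `b₀`; basis independence of the trace then covers
    -- every other unitary basis `b`.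
    refine ⟨b₀ i, fun b hb => ?_⟩
    rw [(g.expMul ψ).sum_chernCurv_eq_of_unitary x (b₀ i) b b₀ hb hb₀]
    simp only [g.chernCurv_expMul, hc, if_true, Complex.ofReal_re]
    rw [← Finset.mul_sum]
    refine mul_pos (Real.exp_pos _) (hi.trans_eq ?_)
    rw [Finset.sum_sub_distrib, hψ, leviForm_smul, Finset.sum_const, Finset.card_univ,
      Fintype.card_fin, nsmul_eq_mul]
    -- The `p` equal Hessian corrections of weight `(p+1)/p` add up to the weight `p+1` in `hi`.
    have hp0 : (p : ℝ) ≠ 0 := by positivity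
    field_simp
  obtain ⟨f, hf⟩ := hconf
  exact ⟨fun p hp => ⟨_, main f hf p hp⟩, main⟩
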